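/- Let $\mathcal X,\mathcal Y$ be finite alphabets, let $\mathcal F$ be a finite set of joint laws (joint cdfs, equivalently pmfs) on $\mathcal X\times\mathcal Y$, and let $P_F$ be a pmf on $\mathcal F$. For $K\ge 1$ blocks of $n$ symbol pairs each, joint laws $F^K=(F_{(1)},\dots,F_{(K)})$ are drawn i.i.d. from $P_F$; given $F^K$ the blocks $(\mathbf X_\tau,\mathbf Y_\tau)$ are independent, and the $n$ symbol pairs of block $\tau$ are i.i.d. with law $F_{(\tau)}$. Let $H_{(\tau)}(X)$ and $H_{(\tau)}(X|Y)$ denote entropy and conditional entropy in bits under $F_{(\tau)}$. Fix sequences $F_X^K,F_Y^K$ of marginals that occur with positive probability, known to both nodes, and let $P_F(\,\cdot\mid F_X^K,F_Y^K)$ be the posterior pmf of $F^K$ given them. Let $\varepsilon>0$. A joint code of rate $R\ge 0$ and block length $n$ consists of an encoder, which maps $\mathbf x^K=(\mathbf x_1,\dots,\mathbf x_K)$ to a message of $\lfloor nR\rfloor$ bits, and a decoder, which maps the message and $\mathbf y^K$ to an estimate $\hat{\mathbf x}^K$. It may depend on $P_F,F_X^K,F_Y^K$ but not on the realized $F^K$.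 Its outage probability is $\mathbb P\{\hat{\mathbf X}^K\ne\mathbf X^K\mid F_X^K,F_Y^K\}$. A rate $R\ge0$ is achievable if there are codes of rate $R$, one for each $n$, with $\limsup_{n\to\infty}$ of the outage probability at most $\varepsilon$. For $\delta>0$, $R$ is achievable by Slepian–Wolf encoding with tolerance $\delta$ if the same holds, with the outage probability averaged also over the binning, for the following encoder and some decoders that know the binning: every sequence $\mathbf x^K$ is assigned independently and uniformly to one of $2^{\lfloor nR\rfloor}$ bins; the message is the bin number of $\mathbf x^K$ if $\mathbf x^K$ is typical, that is, if $\left|-\frac1{Kn}\sum_\tau\log_2 P_{(\tau)}(\mathbf x_\tau)-\frac1K\sum_\tau H_{(\tau)}(X)\right|\le\delta$, where $P_{(\tau)}(\mathbf x_\tau)$ is the probability of $\mathbf x_\tau$ under the given marginal, and a fixed bin number otherwise. Call $R\ge0$ feasible if $$\sum_{F^K\in\mathcal F^K:\ \sum_{\tau=1}^K H_{(\tau)}(X|Y)\ge R}P_F(F^K\mid F_X^K,F_Y^K)\le\varepsilon ,$$ and let $R_X(F_X^K,F_Y^K,\varepsilon)$ be the infimum of the feasible rates. Then the set of feasible rates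 is non-empty; $R_X(F_X^K,F_Y^K,\varepsilon)$ is the infimum of all achievable rates; and for every $\delta>0$ every feasible rate is achievable by Slepian–Wolf encoding with tolerance $\delta$, and $R_X(F_X^K,F_Y^K,\varepsilon)$ is also the infimum of the rates achievable in this way. -/

import Mathlib

open scoped BigOperators

namespace TimeVaryingSW

noncomputable section

/-- The first marginal (law of the symbol of node `X`) of a joint law. -/
def margX {𝒳 𝒴 : Type*} (P : PMF (𝒳 × 𝒴)) : PMF 𝒳 := P.map Prod.fst

/-- The second marginal (law of the symbol of node `Y`) of a joint law. -/
def margY {𝒳 𝒴 : Type*} (P : PMF (𝒳 × 𝒴)) : PMF 𝒴 := P.map Prod.snd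

/-- Shannon entropy in bits. -/
def entropy {𝒳 : Type*} [Fintype 𝒳] (p : PMF 𝒳) : ℝ :=
  ∑ x, -((p x).toReal * Real.logb 2 (p x).toReal)

/-- Conditional entropy `H(X|Y) = ∑ P(x,y) log₂ (P_Y(y) / P(x,y))` in bits; pairs of probability
zero contribute `0`. -/
def condEntropy {𝒳 𝒴 : Type*} [Fintype 𝒳] [Fintype 𝒴] (P : PMF (𝒳 × 𝒴)) : ℝ :=
  ∑ x, ∑ y, (P (x, y)).toReal * Real.logb 2 ((margY P y).toReal / (P (x, y)).toReal)

/-- `K` blocks of `n` symbols each. -/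
abbrev Blocks (A : Type*) (K n : ℕ) : Type _ := Fin K → Fin n → A

/-- Prior probability of a sequence of joint laws: the law of each block is drawn independently
from `PF`. -/
def priorSeq {𝒳 𝒴 : Type*} {𝓕 : Finset (PMF (𝒳 × 𝒴))} (PF : PMF 𝓕) {K : ℕ}
    (F : Fin K → 𝓕) : ℝ :=
  ∏ τ, (PF (F τ)).toReal

/-- The sequence of joint laws `F` has the given sequences of marginals. -/
def HasMarginals {𝒳 𝒴 : Type*} {𝓕 : Finset (PMF (𝒳 × 𝒴))} {K : ℕ}
    (FX : Fin K → PMF 𝒳) (FY : Fin K → PMF 𝒴) (F : Fin K → 𝓕) : Prop :=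
  ∀ τ, margX (F τ : PMF (𝒳 × 𝒴)) = FX τ ∧ margY (F τ : PMF (𝒳 × 𝒴)) = FY τ

open Classical in
/-- Probability that the sequences of marginals of the `K` blocks are `FX` and `FY`. -/
def marginalsProb {𝒳 𝒴 : Type*} {𝓕 : Finset (PMF (𝒳 × 𝒴))} (PF : PMF 𝓕) {K : ℕ}
    (FX : Fin K → PMF 𝒳) (FY : Fin K → PMF 𝒴) : ℝ :=
  ∑ F : Fin K → 𝓕 with HasMarginals FX FY F, priorSeq PF F

open Classical in
/-- Posterior probability of the sequence of joint laws `F` given the sequences of marginals. -/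
def posterior {𝒳 𝒴 : Type*} {𝓕 : Finset (PMF (𝒳 × 𝒴))} (PF : PMF 𝓕) {K : ℕ}
    (FX : Fin K → PMF 𝒳) (FY : Fin K → PMF 𝒴) (F : Fin K → 𝓕) : ℝ :=
  if HasMarginals FX FY F then priorSeq PF F / marginalsProb PF FX FY else 0

/-- Sum over the blocks of the conditional entropies `H(X|Y)`. -/
def sumCondEntropy {𝒳 𝒴 : Type*} [Fintype 𝒳] [Fintype 𝒴] {𝓕 : Finset (PMF (𝒳 × 𝒴))} {K : ℕ}
    (F : Fin K → 𝓕) : ℝ :=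
  ∑ τ, condEntropy (F τ : PMF (𝒳 × 𝒴))

open Classical in
/-- The rates `R ≥ 0` that satisfy the constraint of the optimization problem: the posterior
probability of the sequences with `∑ H(X|Y) ≥ R` is at most `ε`. -/
def feasibleRates {𝒳 𝒴 : Type*} [Fintype 𝒳] [Fintype 𝒴] {𝓕 : Finset (PMF (𝒳 × 𝒴))}
    (PF : PMF 𝓕) {K : ℕ} (FX : Fin K → PMF 𝒳) (FY : Fin K → PMF 𝒴) (ε : ℝ) : Set ℝ :=
  {R | 0 ≤ R ∧ ∑ F : Fin K → 𝓕 with R ≤ sumCondEntropy F, posterior PF FX FY F ≤ ε}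

/-- The value of the optimization problem. -/
def optimalRate {𝒳 𝒴 : Type*} [Fintype 𝒳] [Fintype 𝒴] {𝓕 : Finset (PMF (𝒳 × 𝒴))}
    (PF : PMF 𝓕) {K : ℕ} (FX : Fin K → PMF 𝒳) (FY : Fin K → PMF 𝒴) (ε : ℝ) : ℝ :=
  sInf (feasibleRates PF FX FY ε)

/-- Probability of the observations `x`, `y` under the sequence of joint laws `F`: symbol pairs are
i.i.d. within each block, and the blocks are independent. -/
def obsProb {𝒳 𝒴 : Type*} {𝓕 : Finset (PMF (𝒳 × 𝒴))} {K n : ℕ}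
    (F : Fin K → 𝓕) (x : Blocks 𝒳 K n) (y : Blocks 𝒴 K n) : ℝ :=
  ∏ τ, ∏ i, ((F τ : PMF (𝒳 × 𝒴)) (x τ i, y τ i)).toReal

/-- A message of rate `R` (bits per slot) for block length `n`: a string of `⌊nR⌋` bits. -/
abbrev Message (n : ℕ) (R : ℝ) : Type := Fin ⌊(n : ℝ) * R⌋₊ → Bool

open Classical in
/-- Outage probability, given the sequences of marginals: the probability that the decoder, which
sees the message and `y`, does not reproduce all `K` blocks `x`. -/
def outageProb {𝒳 𝒴 : Type*} [Fintype 𝒳] [Fintype 𝒴] {𝓕 : Finset (PMF (𝒳 × 𝒴))}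
    (PF : PMF 𝓕) {K : ℕ} (FX : Fin K → PMF 𝒳) (FY : Fin K → PMF 𝒴) {n : ℕ} {R : ℝ}
    (enc : Blocks 𝒳 K n → Message n R)
    (dec : Message n R → Blocks 𝒴 K n → Blocks 𝒳 K n) : ℝ :=
  ∑ F : Fin K → 𝓕, posterior PF FX FY F *
    ∑ x : Blocks 𝒳 K n, ∑ y : Blocks 𝒴 K n, if dec (enc x) y = x then 0 else obsProb F x y

/-- The rates achievable by arbitrary joint codes: as the block length grows, the outage probability
is asymptotically at most `ε`. The codes may depend on the prior and on the marginals, but not on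
the realized joint laws. -/
def achievableRates {𝒳 𝒴 : Type*} [Fintype 𝒳] [Fintype 𝒴] {𝓕 : Finset (PMF (𝒳 × 𝒴))}
    (PF : PMF 𝓕) {K : ℕ} (FX : Fin K → PMF 𝒳) (FY : Fin K → PMF 𝒴) (ε : ℝ) : Set ℝ :=
  {R | 0 ≤ R ∧
    ∃ (enc : ∀ n : ℕ, Blocks 𝒳 K n → Message n R)
      (dec : ∀ n : ℕ, Message n R → Blocks 𝒴 K n → Blocks 𝒳 K n),
      ∀ η : ℝ, 0 < η → ∀ᶠ n : ℕ in Filter.atTop,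
        outageProb PF FX FY (enc n) (dec n) ≤ ε + η}

/-- Typical observations of node `X` with tolerance `δ`: the normalized value
`-(1/(Kn)) ∑ log₂ P(x)` differs from `(1/K) ∑ H(X)` by at most `δ` (written without logarithms, so
that observations of probability zero are not typical). -/
def IsTypicalX {𝒳 : Type*} [Fintype 𝒳] {K n : ℕ} (FX : Fin K → PMF 𝒳) (δ : ℝ)
    (x : Blocks 𝒳 K n) : Prop :=
  (2 : ℝ) ^ (-((n : ℝ) * ((∑ τ, entropy (FX τ)) + (K : ℝ) * δ))) ≤ ∏ τ, ∏ i, (FX τ (x τ i)).toReal ∧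
  ∏ τ, ∏ i, (FX τ (x τ i)).toReal ≤ (2 : ℝ) ^ (-((n : ℝ) * ((∑ τ, entropy (FX τ)) - (K : ℝ) * δ)))

open Classical in
/-- Slepian-Wolf encoder for an assignment `bin` of observations to bins: the bin number of `x` if
`x` is typical, and a fixed bin number otherwise. -/
def swEncoder {𝒳 : Type*} [Fintype 𝒳] {K n : ℕ} {R : ℝ} (FX : Fin K → PMF 𝒳) (δ : ℝ)
    (bin : Blocks 𝒳 K n → Message n R) (x : Blocks 𝒳 K n) : Message n R :=
  if IsTypicalX FX δ x then bin x else fun _ => false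

open Classical in
/-- Outage probability of Slepian-Wolf encoding: all observations are distributed independently and
uniformly into the bins, that is, `bin` is uniform over all assignments; the decoder knows `bin`. -/
def swOutageProb {𝒳 𝒴 : Type*} [Fintype 𝒳] [Fintype 𝒴] {𝓕 : Finset (PMF (𝒳 × 𝒴))}
    (PF : PMF 𝓕) {K : ℕ} (FX : Fin K → PMF 𝒳) (FY : Fin K → PMF 𝒴) (δ : ℝ) {n : ℕ} {R : ℝ}
    (dec : (Blocks 𝒳 K n → Message n R) → Message n R → Blocks 𝒴 K n → Blocks 𝒳 K n) : ℝ :=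
  (∑ bin : Blocks 𝒳 K n → Message n R, outageProb PF FX FY (swEncoder FX δ bin) (dec bin)) /
    (Fintype.card (Blocks 𝒳 K n → Message n R) : ℝ)

/-- The rates achievable by Slepian-Wolf encoding (random binning) with typicality tolerance `δ`. -/
def swAchievableRates {𝒳 𝒴 : Type*} [Fintype 𝒳] [Fintype 𝒴] {𝓕 : Finset (PMF (𝒳 × 𝒴))}
    (PF : PMF 𝓕) {K : ℕ} (FX : Fin K → PMF 𝒳) (FY : Fin K → PMF 𝒴) (ε δ : ℝ) : Set ℝ :=
  {R | 0 ≤ R ∧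
    ∃ dec : ∀ n : ℕ,
        (Blocks 𝒳 K n → Message n R) → Message n R → Blocks 𝒴 K n → Blocks 𝒳 K n,
      ∀ η : ℝ, 0 < η → ∀ᶠ n : ℕ in Filter.atTop,
        swOutageProb PF FX FY δ (dec n) ≤ ε + η}

end

end TimeVaryingSW

/-!
Three sets of rates are nested: feasible ⊆ achievable by Slepian-Wolf encoding ⊆ achievable. The
converse `mem_feasibleRates_of_achievable` closes the circle up to an arbitrarily small loss: every
rate strictly above an achievable one is feasible. Hence each set between the feasible and the
achievable rates has the same infimum (`isGLB_optimalRate`).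

Both halves rest on Chebyshev's inequality for finite products (`sum_ite_abs_le`): under a fixed
sequence `F` of joint laws the conditional information density `log₂ (P(y) / P(x,y))` concentrates
around `n ∑ H(X|Y)` (`tendsto_eventProb_condInfo`).

* Converse. For fixed `y` a decoder reproduces at most one `x` per message, so at most `2 ^ (n R)`
  of them; if `∑ H(X|Y) > R`, each of these has conditional probability at most
  about `2 ^ (-n ∑ H(X|Y))` off a negligible event, and the decoder errs with probability tending to one
  (`one_le_eventProb_ne`). The outage probability is therefore asymptotically at least the
  posterior probability of `∑ H(X|Y) ≥ R'`, for each `R' > R`.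
* Direct part. The realized joint laws are unknown, but there are finitely many sequences of them,
  so the decoder can search all `x` that are likely given `y` under some sequence with
  `∑ H(X|Y) < R`. There are so few of these `candidates` that under random binning none of them
  shares the bin of the true `x`, with probability tending to one. The decoder thus succeeds under
  every `F` with `∑ H(X|Y) < R` (`tendsto_swErrorProb`), and the other `F` contribute at most their
  posterior probability, which is at most `ε` by feasibility. Some binning is as good as the average
  (`swAchievableRates_subset_achievableRates`).
-/

open scoped BigOperators

namespace TimeVaryingSW

noncomputable section

/-! ### Second moments and Chebyshev's inequality for finite products -/

theorem sum_pi_prod {ι A : Type*} [Fintype ι] [DecidableEq ι] [Fintype A] (g : ι → A → ℝ) :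
    ∑ ω : ι → A, ∏ i, g i (ω i) = ∏ i, ∑ a, g i a := by
  rw [Finset.prod_univ_sum, Fintype.piFinset_univ]

theorem sum_blocks_prod {A : Type*} [Fintype A] {K n : ℕ} (g : Fin K → Fin n → A → ℝ) :
    ∑ ω : Blocks A K n, ∏ τ, ∏ i, g τ i (ω τ i) = ∏ τ, ∏ i, ∑ a, g τ i a := by
  rw [sum_pi_prod (fun τ (w : Fin n → A) => ∏ i, g τ i (w i))]
  exact Finset.prod_congr rfl fun τ _ => sum_pi_prod _

/-- Independent centred variables are uncorrelated. -/
theorem sum_prod_mul_mul {ι A : Type*} [Fintype ι] [DecidableEq ι] [Fintype A]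
    (p f : ι → A → ℝ) (hp : ∀ i, ∑ a, p i a = 1) (hf : ∀ i, ∑ a, p i a * f i a = 0) (i j : ι) :
    ∑ ω : ι → A, (∏ k, p k (ω k)) * (f i (ω i) * f j (ω j)) =
      if i = j then ∑ a, p i a * f i a ^ 2 else 0 := by
  have key : ∀ ω : ι → A, (∏ k, p k (ω k)) * (f i (ω i) * f j (ω j)) =
      ∏ k, (p k (ω k) * ((if k = i then f k (ω k) else 1) * (if k = j then f k (ω k) else 1))) := by
    intro ω
    simp only [Finset.prod_mul_distrib, Finset.prod_ite_eq', Finset.mem_univ, if_true]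
  simp_rw [key]
  rw [sum_pi_prod (fun k a => p k a * ((if k = i then f k a else 1) * (if k = j then f k a else 1)))]
  split_ifs with h
  · subst h
    rw [Finset.prod_eq_single i]
    · simp [sq]
    · intro k _ hk
      simp [hk, hp]
    · simp
  · apply Finset.prod_eq_zero (Finset.mem_univ i)
    simp [h, hf]

/-- The variance of a sum of independent centred variables is the sum of the variances. -/
theorem sum_prod_mul_sum_sq {ι A : Type*} [Fintype ι] [DecidableEq ι] [Fintype A]
    (p f : ι → A → ℝ) (hp : ∀ i, ∑ a, p i a = 1) (hf : ∀ i, ∑ a, p i a * f i a = 0) :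
    ∑ ω : ι → A, (∏ k, p k (ω k)) * (∑ i, f i (ω i)) ^ 2 = ∑ i, ∑ a, p i a * f i a ^ 2 := by
  have : ∀ ω : ι → A, (∏ k, p k (ω k)) * (∑ i, f i (ω i)) ^ 2 =
      ∑ i, ∑ j, (∏ k, p k (ω k)) * (f i (ω i) * f j (ω j)) := by
    intro ω
    rw [sq, Finset.sum_mul_sum, Finset.mul_sum]
    simp_rw [Finset.mul_sum]
  simp_rw [this]
  rw [Finset.sum_comm]
  refine Finset.sum_congr rfl fun i _ => ?_
  rw [Finset.sum_comm]
  simp_rw [sum_prod_mul_mul p f hp hf]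
  simp

open Classical in
/-- Chebyshev's inequality for a sum of independent centred variables. -/
theorem sum_ite_abs_le {ι A : Type*} [Fintype ι] [DecidableEq ι] [Fintype A]
    (p f : ι → A → ℝ) (hp0 : ∀ i a, 0 ≤ p i a) (hp : ∀ i, ∑ a, p i a = 1)
    (hf : ∀ i, ∑ a, p i a * f i a = 0) {t : ℝ} (ht : 0 < t) :
    (∑ ω : ι → A, if t ≤ |∑ i, f i (ω i)| then ∏ k, p k (ω k) else 0) ≤
      (∑ i, ∑ a, p i a * f i a ^ 2) / t ^ 2 := by
  rw [← sum_prod_mul_sum_sq p f hp hf, Finset.sum_div]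
  refine Finset.sum_le_sum fun ω _ => ?_
  have h0 : 0 ≤ ∏ k, p k (ω k) := Finset.prod_nonneg fun k _ => hp0 k _
  split_ifs with h
  · rw [le_div_iff₀ (by positivity), ← sq_abs (∑ i, f i (ω i))]
    gcongr
  · positivity

/-! ### Laws of the observations -/

theorem sum_toReal_eq_one {A : Type*} [Fintype A] (p : PMF A) : ∑ a, (p a).toReal = 1 := by
  rw [← ENNReal.toReal_sum (fun a _ => p.apply_ne_top a), ← tsum_fintype (L := .unconditional _),
    p.tsum_coe]
  rfl

theorem margX_toReal {𝒳 𝒴 : Type*} [Fintype 𝒳] [Fintype 𝒴] (P : PMF (𝒳 × 𝒴)) (x : 𝒳) :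
    (margX P x).toReal = ∑ y, (P (x, y)).toReal := by
  classical
  rw [margX, PMF.map_apply, tsum_fintype, Fintype.sum_prod_type,
    ← ENNReal.toReal_sum (fun a _ => P.apply_ne_top _)]
  congr 1
  rw [Finset.sum_eq_single x]
  · simp
  · intro b _ hb
    simp [hb.symm]
  · simp

theorem margY_toReal {𝒳 𝒴 : Type*} [Fintype 𝒳] [Fintype 𝒴] (P : PMF (𝒳 × 𝒴)) (y : 𝒴) :
    (margY P y).toReal = ∑ x, (P (x, y)).toReal := by
  classical
  rw [margY, PMF.map_apply, tsum_fintype, Fintype.sum_prod_type_right,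
    ← ENNReal.toReal_sum (fun a _ => P.apply_ne_top _)]
  congr 1
  rw [Finset.sum_eq_single y]
  · simp
  · intro b _ hb
    simp [hb.symm]
  · simp

/-- Probability of the observations `y` of node `Y` under the sequence of joint laws `F`. -/
def obsProbY {𝒳 𝒴 : Type*} {𝓕 : Finset (PMF (𝒳 × 𝒴))} {K n : ℕ}
    (F : Fin K → 𝓕) (y : Blocks 𝒴 K n) : ℝ :=
  ∏ τ, ∏ i, (margY (F τ : PMF (𝒳 × 𝒴)) (y τ i)).toReal

theorem obsProb_nonneg {𝒳 𝒴 : Type*} {𝓕 : Finset (PMF (𝒳 × 𝒴))} {K n : ℕ}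
    (F : Fin K → 𝓕) (x : Blocks 𝒳 K n) (y : Blocks 𝒴 K n) :
    0 ≤ obsProb F x y :=
  Finset.prod_nonneg fun _ _ => Finset.prod_nonneg fun _ _ => ENNReal.toReal_nonneg

theorem obsProbY_nonneg {𝒳 𝒴 : Type*} {𝓕 : Finset (PMF (𝒳 × 𝒴))} {K n : ℕ}
    (F : Fin K → 𝓕) (y : Blocks 𝒴 K n) : 0 ≤ obsProbY F y :=
  Finset.prod_nonneg fun _ _ => Finset.prod_nonneg fun _ _ => ENNReal.toReal_nonneg

theorem sum_obsProbY {𝒳 𝒴 : Type*} [Fintype 𝒴] {𝓕 : Finset (PMF (𝒳 × 𝒴))} {K n : ℕ}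
    (F : Fin K → 𝓕) : ∑ y : Blocks 𝒴 K n, obsProbY F y = 1 := by
  simp only [obsProbY]
  rw [sum_blocks_prod (fun τ _ a => (margY (F τ : PMF (𝒳 × 𝒴)) a).toReal)]
  simp [sum_toReal_eq_one]

variable {𝒳 𝒴 : Type*} [Fintype 𝒳] [Fintype 𝒴] {𝓕 : Finset (PMF (𝒳 × 𝒴))} {K : ℕ}

theorem sum_obsProb_left {n : ℕ} (F : Fin K → 𝓕) (y : Blocks 𝒴 K n) :
    ∑ x, obsProb F x y = obsProbY F y := by
  simp only [obsProb, obsProbY, margY_toReal]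
  exact sum_blocks_prod (fun τ i a => ((F τ : PMF (𝒳 × 𝒴)) (a, y τ i)).toReal)

theorem sum_obsProb {n : ℕ} (F : Fin K → 𝓕) :
    ∑ x : Blocks 𝒳 K n, ∑ y : Blocks 𝒴 K n, obsProb F x y = 1 := by
  rw [Finset.sum_comm]
  simp_rw [sum_obsProb_left, sum_obsProbY]

open Classical in
/-- Probability of an event about the observations under the sequence of joint laws `F`. -/
def eventProb {n : ℕ} (F : Fin K → 𝓕) (E : Blocks 𝒳 K n → Blocks 𝒴 K n → Prop) : ℝ :=
  ∑ x, ∑ y, if E x y then obsProb F x y else 0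

theorem eventProb_nonneg {n : ℕ} (F : Fin K → 𝓕) (E : Blocks 𝒳 K n → Blocks 𝒴 K n → Prop) :
    0 ≤ eventProb F E :=
  Finset.sum_nonneg fun x _ => Finset.sum_nonneg fun y _ => by
    split_ifs
    exacts [obsProb_nonneg F x y, le_rfl]

theorem eventProb_mono {n : ℕ} (F : Fin K → 𝓕) {E E' : Blocks 𝒳 K n → Blocks 𝒴 K n → Prop}
    (h : ∀ x y, 0 < obsProb F x y → E x y → E' x y) : eventProb F E ≤ eventProb F E' :=
  Finset.sum_le_sum fun x _ => Finset.sum_le_sum fun y _ => by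
    rcases (obsProb_nonneg F x y).eq_or_lt with h0 | h0
    · simp [← h0]
    · have := h x y h0
      split_ifs <;> first | tauto | exact le_rfl | exact h0.le

theorem eventProb_le_one {n : ℕ} (F : Fin K → 𝓕) (E : Blocks 𝒳 K n → Blocks 𝒴 K n → Prop) :
    eventProb F E ≤ 1 := by
  rw [← sum_obsProb F (n := n)]
  refine Finset.sum_le_sum fun x _ => Finset.sum_le_sum fun y _ => ?_
  split_ifs
  exacts [le_rfl, obsProb_nonneg F x y]

/-! ### Concentration -/

/-- Weak law of large numbers for a sum over all symbol pairs of all blocks. -/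
theorem tendsto_eventProb_deviation (F : Fin K → 𝓕) (z : Fin K → 𝒳 × 𝒴 → ℝ) {γ : ℝ}
    (hγ : 0 < γ) :
    Filter.Tendsto (fun n : ℕ => eventProb (n := n) F fun x y =>
      (n : ℝ) * γ ≤ |∑ τ, ∑ i, z τ (x τ i, y τ i) -
        n * ∑ τ, ∑ a, ((F τ : PMF (𝒳 × 𝒴)) a).toReal * z τ a|) Filter.atTop (nhds 0) := by
  classical
  set p : Fin K → 𝒳 × 𝒴 → ℝ := fun τ a => ((F τ : PMF (𝒳 × 𝒴)) a).toReal with hpdef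
  set m : Fin K → ℝ := fun τ => ∑ a, p τ a * z τ a with hm
  set V : ℝ := ∑ τ, ∑ a, p τ a * (z τ a - m τ) ^ 2 with hV
  have hp1 : ∀ τ, ∑ a, p τ a = 1 := fun τ => sum_toReal_eq_one _
  have hbound : ∀ n : ℕ, 0 < n → eventProb (n := n) F (fun x y =>
      (n : ℝ) * γ ≤ |∑ τ, ∑ i, z τ (x τ i, y τ i) - n * ∑ τ, ∑ a, p τ a * z τ a|) ≤
      V / γ ^ 2 * (1 / n) := by
    intro n hn
    have hn' : (0 : ℝ) < n := by exact_mod_cast hn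
    have hc := sum_ite_abs_le (ι := Fin K × Fin n) (fun k => p k.1)
      (fun k a => z k.1 a - m k.1) (fun _ _ => ENNReal.toReal_nonneg) (fun k => hp1 k.1)
      (fun k => by simp [mul_sub, Finset.sum_sub_distrib, ← Finset.sum_mul, hp1, hm])
      (t := n * γ) (by positivity)
    let e : (Blocks 𝒳 K n × Blocks 𝒴 K n) ≃ (Fin K × Fin n → 𝒳 × 𝒴) :=
      { toFun := fun w k => (w.1 k.1 k.2, w.2 k.1 k.2)
        invFun := fun ω => (fun τ i => (ω (τ, i)).1, fun τ i => (ω (τ, i)).2)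
        left_inv := fun _ => rfl
        right_inv := fun _ => rfl }
    rw [← e.sum_comp, Fintype.sum_prod_type] at hc
    have hvar : (∑ i : Fin K × Fin n, ∑ a, p i.1 a * (z i.1 a - m i.1) ^ 2) / (n * γ) ^ 2 =
        V / γ ^ 2 * (1 / n) := by
      rw [Fintype.sum_prod_type]
      simp only [Finset.sum_const, Finset.card_univ, Fintype.card_fin, nsmul_eq_mul]
      rw [← Finset.mul_sum, ← hV]
      field_simp
    rw [hvar] at hc
    refine le_trans (le_of_eq ?_) hc
    refine Finset.sum_congr rfl fun x _ => Finset.sum_congr rfl fun y _ => ?_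
    have h1 : ∑ τ, ∑ i, z τ (x τ i, y τ i) - n * ∑ τ, ∑ a, p τ a * z τ a =
        ∑ k : Fin K × Fin n, (z k.1 (e (x, y) k) - m k.1) := by
      rw [Finset.sum_sub_distrib, Fintype.sum_prod_type, Fintype.sum_prod_type]
      simp [e, hm, Finset.mul_sum]
    have h2 : obsProb F x y = ∏ k : Fin K × Fin n, p k.1 (e (x, y) k) := by
      rw [Fintype.prod_prod_type]
      rfl
    beta_reduce
    rw [h1, h2]
  refine squeeze_zero' (Filter.Eventually.of_forall fun n => eventProb_nonneg _ _)
    (Filter.eventually_atTop.2 ⟨1, fun n hn => hbound n hn⟩) ?_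
  simpa using (tendsto_one_div_atTop_nhds_zero_nat (𝕜 := ℝ)).const_mul (V / γ ^ 2)

theorem pos_of_obsProb_pos {𝒳 𝒴 : Type*} {𝓕 : Finset (PMF (𝒳 × 𝒴))} {K n : ℕ}
    {F : Fin K → 𝓕} {x : Blocks 𝒳 K n} {y : Blocks 𝒴 K n} (h : 0 < obsProb F x y)
    (τ : Fin K) (i : Fin n) : 0 < ((F τ : PMF (𝒳 × 𝒴)) (x τ i, y τ i)).toReal := by
  refine lt_of_le_of_ne ENNReal.toReal_nonneg fun h0 => h.ne' ?_
  exact Finset.prod_eq_zero (Finset.mem_univ τ) (Finset.prod_eq_zero (Finset.mem_univ i) h0.symm)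

/-- `2` to the power of a sum of logarithms over all blocks. -/
theorem two_rpow_sum_logb {K n : ℕ} {w : Fin K → Fin n → ℝ} (hw : ∀ τ i, 0 < w τ i) :
    (2 : ℝ) ^ (∑ τ, ∑ i, Real.logb 2 (w τ i)) = ∏ τ, ∏ i, w τ i := by
  simp_rw [Real.rpow_sum_of_pos (two_pos : (0 : ℝ) < 2)]
  refine Finset.prod_congr rfl fun τ _ => Finset.prod_congr rfl fun i _ => ?_
  exact Real.rpow_logb two_pos (by norm_num) (hw τ i)

theorem le_margX (P : PMF (𝒳 × 𝒴)) (x : 𝒳) (y : 𝒴) :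
    (P (x, y)).toReal ≤ (margX P x).toReal := by
  rw [margX_toReal]
  exact Finset.single_le_sum (f := fun y => (P (x, y)).toReal)
    (fun _ _ => ENNReal.toReal_nonneg) (Finset.mem_univ y)

theorem le_margY (P : PMF (𝒳 × 𝒴)) (x : 𝒳) (y : 𝒴) :
    (P (x, y)).toReal ≤ (margY P y).toReal := by
  rw [margY_toReal]
  exact Finset.single_le_sum (f := fun x => (P (x, y)).toReal)
    (fun _ _ => ENNReal.toReal_nonneg) (Finset.mem_univ x)

theorem obsProb_le_obsProbY {n : ℕ} (F : Fin K → 𝓕) (x : Blocks 𝒳 K n) (y : Blocks 𝒴 K n) :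
    obsProb F x y ≤ obsProbY F y := by
  rw [← sum_obsProb_left]
  exact Finset.single_le_sum (f := fun x => obsProb F x y)
    (fun x _ => obsProb_nonneg F x y) (Finset.mem_univ x)

/-- Conditional information density `log₂ (P(y) / P(x,y))` of the observations, as a sum over the
symbol pairs. It is meaningful only where `obsProb F x y` is positive. -/
def condInfo {𝒳 𝒴 : Type*} {𝓕 : Finset (PMF (𝒳 × 𝒴))} {K n : ℕ}
    (F : Fin K → 𝓕) (x : Blocks 𝒳 K n) (y : Blocks 𝒴 K n) : ℝ :=
  ∑ τ, ∑ i, Real.logb 2 ((margY (F τ : PMF (𝒳 × 𝒴)) (y τ i)).toReal /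
    ((F τ : PMF (𝒳 × 𝒴)) (x τ i, y τ i)).toReal)

theorem obsProb_mul_two_rpow_condInfo {n : ℕ} {F : Fin K → 𝓕} {x : Blocks 𝒳 K n}
    {y : Blocks 𝒴 K n} (h : 0 < obsProb F x y) :
    obsProb F x y * 2 ^ condInfo F x y = obsProbY F y := by
  have hpos := pos_of_obsProb_pos h
  rw [condInfo, two_rpow_sum_logb fun τ i =>
    div_pos ((hpos τ i).trans_le (le_margY _ _ _)) (hpos τ i)]
  simp only [Finset.prod_div_distrib]
  rw [← obsProbY, ← obsProb]
  field_simp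

/-- The conditional information density concentrates around `n ∑ H(X|Y)`. -/
theorem tendsto_eventProb_condInfo (F : Fin K → 𝓕) {γ : ℝ} (hγ : 0 < γ) :
    Filter.Tendsto (fun n : ℕ => eventProb (n := n) F fun x y =>
      (n : ℝ) * γ ≤ |condInfo F x y - n * sumCondEntropy F|) Filter.atTop (nhds 0) := by
  have h := tendsto_eventProb_deviation F (fun τ a =>
    Real.logb 2 ((margY (F τ : PMF (𝒳 × 𝒴)) a.2).toReal / ((F τ : PMF (𝒳 × 𝒴)) a).toReal)) hγ
  simpa only [Fintype.sum_prod_type, condInfo, sumCondEntropy, condEntropy] using h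

/-- The observations of node `X` are typical with probability tending to one. -/
theorem tendsto_eventProb_not_isTypicalX (hK : 1 ≤ K) {FX : Fin K → PMF 𝒳} {F : Fin K → 𝓕}
    (hF : ∀ τ, margX (F τ : PMF (𝒳 × 𝒴)) = FX τ) {δ : ℝ} (hδ : 0 < δ) :
    Filter.Tendsto (fun n : ℕ => eventProb (n := n) F fun x _ => ¬ IsTypicalX FX δ x)
      Filter.atTop (nhds 0) := by
  have hKδ : 0 < (K : ℝ) * δ := mul_pos (by exact_mod_cast hK) hδ
  have h := tendsto_eventProb_deviation F (fun τ a => -Real.logb 2 (FX τ a.1).toReal) hKδ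
  refine squeeze_zero (fun n => eventProb_nonneg _ _) (fun n => eventProb_mono F ?_) h
  intro x y hxy hx
  have hmean : ∑ τ, ∑ a, ((F τ : PMF (𝒳 × 𝒴)) a).toReal * -Real.logb 2 (FX τ a.1).toReal =
      ∑ τ, entropy (FX τ) := by
    refine Finset.sum_congr rfl fun τ _ => ?_
    rw [Fintype.sum_prod_type, entropy]
    refine Finset.sum_congr rfl fun a _ => ?_
    dsimp only
    rw [← Finset.sum_mul, ← margX_toReal, hF]
    ring
  rw [hmean]
  by_contra hdev
  rw [not_le, abs_lt] at hdev
  refine hx ?_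
  have hprod := two_rpow_sum_logb (w := fun τ i => (FX τ (x τ i)).toReal) fun τ i => by
    rw [← hF]
    exact (pos_of_obsProb_pos hxy τ i).trans_le (le_margX _ _ _)
  simp only [Finset.sum_neg_distrib] at hdev
  unfold IsTypicalX
  rw [← hprod]
  constructor
  · exact Real.rpow_le_rpow_of_exponent_le one_le_two (by nlinarith [hdev.2])
  · exact Real.rpow_le_rpow_of_exponent_le one_le_two (by nlinarith [hdev.1])

/-! ### Posterior, outage probability and number of messages -/

theorem priorSeq_nonneg {𝒳 𝒴 : Type*} {𝓕 : Finset (PMF (𝒳 × 𝒴))} {K : ℕ} (PF : PMF 𝓕)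
    (F : Fin K → 𝓕) : 0 ≤ priorSeq PF F :=
  Finset.prod_nonneg fun _ _ => ENNReal.toReal_nonneg

theorem posterior_nonneg {𝒳 𝒴 : Type*} {𝓕 : Finset (PMF (𝒳 × 𝒴))} {K : ℕ} (PF : PMF 𝓕)
    (FX : Fin K → PMF 𝒳) (FY : Fin K → PMF 𝒴) (F : Fin K → 𝓕) : 0 ≤ posterior PF FX FY F := by
  unfold posterior
  split_ifs
  · exact div_nonneg (priorSeq_nonneg _ _) (Finset.sum_nonneg fun _ _ => priorSeq_nonneg _ _)
  · exact le_rfl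

theorem outageProb_eq {PF : PMF 𝓕} {FX : Fin K → PMF 𝒳} {FY : Fin K → PMF 𝒴} {n : ℕ} {R : ℝ}
    (enc : Blocks 𝒳 K n → Message n R) (dec : Message n R → Blocks 𝒴 K n → Blocks 𝒳 K n) :
    outageProb PF FX FY enc dec = ∑ F : Fin K → 𝓕, posterior PF FX FY F *
      eventProb F fun x y => dec (enc x) y ≠ x := by
  refine Finset.sum_congr rfl fun F _ => congrArg _ ?_
  refine Finset.sum_congr rfl fun x _ => Finset.sum_congr rfl fun y _ => ?_
  by_cases h : dec (enc x) y = x <;> simp [h]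

theorem card_message (n : ℕ) (R : ℝ) : (Fintype.card (Message n R) : ℝ) = 2 ^ ⌊(n : ℝ) * R⌋₊ := by
  simp [Message]

theorem card_message_le {n : ℕ} {R : ℝ} (hR : 0 ≤ R) :
    (Fintype.card (Message n R) : ℝ) ≤ 2 ^ ((n : ℝ) * R) := by
  rw [card_message, ← Real.rpow_natCast]
  exact Real.rpow_le_rpow_of_exponent_le one_le_two (Nat.floor_le (by positivity))

theorem two_rpow_le_card_message (n : ℕ) (R : ℝ) :
    (2 : ℝ) ^ ((n : ℝ) * R - 1) ≤ Fintype.card (Message n R) := by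
  rw [card_message, ← Real.rpow_natCast]
  exact Real.rpow_le_rpow_of_exponent_le one_le_two (Nat.sub_one_lt_floor _).le

theorem tendsto_two_rpow_neg {c : ℝ} (hc : 0 < c) :
    Filter.Tendsto (fun n : ℕ => (2 : ℝ) ^ (-(n * c))) Filter.atTop (nhds 0) := by
  have h := tendsto_pow_atTop_nhds_zero_of_lt_one (r := (2 : ℝ) ^ (-c)) (by positivity)
    (Real.rpow_lt_one_of_one_lt_of_neg one_lt_two (by linarith))
  refine h.congr fun n => ?_
  rw [← Real.rpow_natCast, ← Real.rpow_mul two_pos.le]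
  ring_nf

/-! ### Converse -/

open Classical in
/-- For fixed `y`, a decoder reproduces at most one observation `x` per message. -/
theorem card_correct_le {A M : Type*} [Fintype A] [Fintype M] (enc : A → M) (dec : M → A) :
    (Finset.univ.filter fun x => dec (enc x) = x).card ≤ Fintype.card M := by
  refine Finset.card_le_card_of_injOn enc (fun _ _ => Finset.mem_univ _) ?_
  intro a ha b hb hab
  simp only [Finset.coe_filter, Finset.mem_univ, true_and, Set.mem_ofPred_eq] at ha hb
  rw [← ha, ← hb, hab]

/-- Converse for a fixed sequence of joint laws: a decoder errs unless the conditional information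
density deviates from `n ∑ H(X|Y)` or the number of messages is of order `2 ^ (n ∑ H(X|Y))`. -/
theorem one_le_eventProb_ne {n : ℕ} {M : Type*} [Fintype M] (F : Fin K → 𝓕) (γ : ℝ)
    (enc : Blocks 𝒳 K n → M) (dec : M → Blocks 𝒴 K n → Blocks 𝒳 K n) :
    1 ≤ eventProb F (fun x y => dec (enc x) y ≠ x) +
      eventProb (n := n) F (fun x y => (n : ℝ) * γ ≤ |condInfo F x y - n * sumCondEntropy F|) +
      Fintype.card M * 2 ^ (-(n * (sumCondEntropy F - γ))) := by
  classical
  set q : ℝ := 2 ^ (-(n * (sumCondEntropy F - γ))) with hq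
  have hq0 : 0 ≤ q := by positivity
  have hcorr : ∑ x, ∑ y, (if dec (enc x) y = x then obsProbY F y * q else 0) ≤
      Fintype.card M * q := by
    rw [Finset.sum_comm, ← mul_one (Fintype.card M * q : ℝ), ← sum_obsProbY F (n := n),
      Finset.mul_sum]
    refine Finset.sum_le_sum fun y _ => ?_
    rw [← Finset.sum_filter, Finset.sum_const, nsmul_eq_mul]
    have hc : ((Finset.univ.filter fun x => dec (enc x) y = x).card : ℝ) ≤ Fintype.card M := by
      have := card_correct_le enc (fun m => dec m y)
      exact_mod_cast (by convert this)
    calc _ ≤ (Fintype.card M : ℝ) * (obsProbY F y * q) :=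
          mul_le_mul_of_nonneg_right hc (mul_nonneg (obsProbY_nonneg F y) hq0)
      _ = _ := by ring
  refine le_trans ?_ (add_le_add le_rfl hcorr)
  rw [← sum_obsProb F (n := n)]
  simp only [eventProb, ← Finset.sum_add_distrib]
  refine Finset.sum_le_sum fun x _ => Finset.sum_le_sum fun y _ => ?_
  rcases (obsProb_nonneg F x y).eq_or_lt with h0 | h0
  · have := mul_nonneg (obsProbY_nonneg F y) hq0
    simp only [← h0, ite_self, zero_add]
    split_ifs <;> simp [this]
  by_cases h1 : dec (enc x) y = x
  · by_cases h2 : (n : ℝ) * γ ≤ |condInfo F x y - n * sumCondEntropy F|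
    · have := mul_nonneg (obsProbY_nonneg F y) hq0
      simp [h1, h2, this]
    · have h3 : obsProb F x y ≤ obsProbY F y * q := by
        rw [← obsProb_mul_two_rpow_condInfo h0, hq, mul_assoc, ← Real.rpow_add two_pos]
        refine le_mul_of_one_le_right h0.le (Real.one_le_rpow one_le_two ?_)
        have := (abs_lt.1 (not_le.1 h2)).1
        nlinarith
      simpa [h1, h2] using h3
  · have := obsProb_nonneg F x y
    simp only [h1, ne_eq, not_false_eq_true, if_true, if_false]
    split_ifs <;> linarith

/-- Converse: every rate above an achievable rate is feasible. -/
theorem mem_feasibleRates_of_achievable {PF : PMF 𝓕} {FX : Fin K → PMF 𝒳} {FY : Fin K → PMF 𝒴}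
    {ε R R' : ℝ} (hR : R ∈ achievableRates PF FX FY ε) (hRR' : R < R') :
    R' ∈ feasibleRates PF FX FY ε := by
  classical
  obtain ⟨hR0, enc, dec, hcode⟩ := hR
  refine ⟨hR0.trans hRR'.le, ?_⟩
  -- Half of the gap absorbs the deviation of the information density, the other half makes the
  -- number of messages negligible.
  set γ : ℝ := (R' - R) / 2 with hγ
  have hγ0 : 0 < γ := by rw [hγ]; linarith
  set g : ℕ → ℝ := fun n => ∑ F : Fin K → 𝓕 with R' ≤ sumCondEntropy F, posterior PF FX FY F *
    (eventProb (n := n) F (fun x y => (n : ℝ) * γ ≤ |condInfo F x y - n * sumCondEntropy F|) +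
      2 ^ (-(n * γ))) with hg
  have hg0 : Filter.Tendsto g Filter.atTop (nhds 0) := by
    have := tendsto_finsetSum (Finset.univ.filter fun F : Fin K → 𝓕 => R' ≤ sumCondEntropy F)
      fun F _ => ((tendsto_eventProb_condInfo F hγ0).add (tendsto_two_rpow_neg hγ0)).const_mul
        (posterior PF FX FY F)
    simpa using this
  have hbound : ∀ n, ∑ F : Fin K → 𝓕 with R' ≤ sumCondEntropy F, posterior PF FX FY F ≤
      outageProb PF FX FY (enc n) (dec n) + g n := by
    intro n
    have h1 : ∑ F : Fin K → 𝓕 with R' ≤ sumCondEntropy F, posterior PF FX FY F *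
        eventProb F (fun x y => dec n (enc n x) y ≠ x) ≤
        outageProb PF FX FY (enc n) (dec n) := by
      rw [outageProb_eq]
      exact Finset.sum_le_sum_of_subset_of_nonneg (Finset.filter_subset _ _) fun F _ _ =>
        mul_nonneg (posterior_nonneg PF FX FY F) (eventProb_nonneg _ _)
    refine le_trans ?_ (add_le_add h1 le_rfl)
    rw [hg, ← Finset.sum_add_distrib]
    refine Finset.sum_le_sum fun F hF => ?_
    have hFR : R' ≤ sumCondEntropy F := (Finset.mem_filter.1 hF).2
    rw [← mul_add]
    refine le_mul_of_one_le_right (posterior_nonneg PF FX FY F) ?_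
    refine (one_le_eventProb_ne F γ (enc n) (dec n)).trans ?_
    rw [add_assoc]
    gcongr
    calc (Fintype.card (Message n R) : ℝ) * 2 ^ (-(n * (sumCondEntropy F - γ)))
        ≤ 2 ^ ((n : ℝ) * R) * 2 ^ (-(n * (sumCondEntropy F - γ))) := by
          gcongr
          exact card_message_le hR0
      _ = 2 ^ (-(n * (sumCondEntropy F - γ - R))) := by
          rw [← Real.rpow_add two_pos]
          ring_nf
      _ ≤ 2 ^ (-(n * γ)) := by
          refine Real.rpow_le_rpow_of_exponent_le one_le_two ?_
          have : γ ≤ sumCondEntropy F - γ - R := by rw [hγ]; linarith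
          gcongr
  refine le_of_forall_pos_le_add fun η hη => ?_
  obtain ⟨n, hn1, hn2⟩ := ((hcode (η / 2) (half_pos hη)).and
    (hg0.eventually_lt_const (half_pos hη))).exists
  linarith [hbound n]

/-! ### Universal decoder and random binning -/

/-- The observations of node `X` that the decoder considers, given `y`: those whose conditional
probability given `y` is at least `2 ^ (-n (H + R) / 2)` under some sequence of joint laws with
`H = ∑ H(X|Y) < R`. -/
def candidates (𝓕 : Finset (PMF (𝒳 × 𝒴))) (R : ℝ) {K n : ℕ} (y : Blocks 𝒴 K n) :
    Set (Blocks 𝒳 K n) :=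
  {x | ∃ F : Fin K → 𝓕, sumCondEntropy F < R ∧ 0 < obsProb F x y ∧
    obsProbY F y ≤ obsProb F x y * 2 ^ ((n : ℝ) * ((sumCondEntropy F + R) / 2))}

open Classical in
/-- Each sequence of joint laws contributes candidates whose conditional probabilities given `y` sum
to at most one. -/
theorem card_candidates_le (R : ℝ) {n : ℕ} (y : Blocks 𝒴 K n) :
    ((Finset.univ.filter fun x => x ∈ candidates 𝓕 R y).card : ℝ) ≤
      ∑ F : Fin K → 𝓕 with sumCondEntropy F < R,
        2 ^ ((n : ℝ) * ((sumCondEntropy F + R) / 2)) := by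
  have hsub : (Finset.univ.filter fun x => x ∈ candidates 𝓕 R y) ⊆
      (Finset.univ.filter fun F : Fin K → 𝓕 => sumCondEntropy F < R).biUnion fun F =>
        Finset.univ.filter fun x => 0 < obsProb F x y ∧
          obsProbY F y ≤ obsProb F x y * 2 ^ ((n : ℝ) * ((sumCondEntropy F + R) / 2)) := by
    intro x hx
    obtain ⟨F, h1, h2, h3⟩ := (Finset.mem_filter.1 hx).2
    simp only [Finset.mem_biUnion, Finset.mem_filter, Finset.mem_univ, true_and]
    exact ⟨F, h1, h2, h3⟩
  refine (Nat.cast_le.2 ((Finset.card_le_card hsub).trans Finset.card_biUnion_le)).trans ?_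
  rw [Nat.cast_sum]
  refine Finset.sum_le_sum fun F _ => ?_
  set T := Finset.univ.filter fun x => 0 < obsProb F x y ∧
    obsProbY F y ≤ obsProb F x y * 2 ^ ((n : ℝ) * ((sumCondEntropy F + R) / 2)) with hT
  rcases T.eq_empty_or_nonempty with h0 | ⟨x₀, hx₀⟩
  · rw [h0]
    simp only [Finset.card_empty, Nat.cast_zero]
    positivity
  · have hY : 0 < obsProbY F y :=
      (Finset.mem_filter.1 hx₀).2.1.trans_le (obsProb_le_obsProbY F x₀ y)
    refine le_of_mul_le_mul_right ?_ hY
    calc (T.card : ℝ) * obsProbY F y = ∑ x ∈ T, obsProbY F y := by simp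
      _ ≤ ∑ x ∈ T, obsProb F x y * 2 ^ ((n : ℝ) * ((sumCondEntropy F + R) / 2)) :=
          Finset.sum_le_sum fun x hx => (Finset.mem_filter.1 hx).2.2
      _ ≤ ∑ x, obsProb F x y * 2 ^ ((n : ℝ) * ((sumCondEntropy F + R) / 2)) :=
          Finset.sum_le_sum_of_subset_of_nonneg (Finset.subset_univ _) fun x _ _ =>
            mul_nonneg (obsProb_nonneg F x y) (by positivity)
      _ = _ := by rw [← Finset.sum_mul, sum_obsProb_left, mul_comm]

open Classical in
/-- Slepian-Wolf decoder: any typical candidate in the announced bin. -/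
def swDecoder [Nonempty 𝒳] (𝓕 : Finset (PMF (𝒳 × 𝒴))) (FX : Fin K → PMF 𝒳) (δ : ℝ) {n : ℕ}
    {R : ℝ} (bin : Blocks 𝒳 K n → Message n R) (m : Message n R) (y : Blocks 𝒴 K n) :
    Blocks 𝒳 K n :=
  if h : ∃ x, IsTypicalX FX δ x ∧ x ∈ candidates 𝓕 R y ∧ bin x = m then h.choose
  else Classical.arbitrary _

/-- If a typical candidate is decoded wrongly, another candidate shares its bin. -/
theorem exists_collision [Nonempty 𝒳] {FX : Fin K → PMF 𝒳} {δ : ℝ} {n : ℕ} {R : ℝ}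
    {bin : Blocks 𝒳 K n → Message n R} {x : Blocks 𝒳 K n} {y : Blocks 𝒴 K n}
    (hx : IsTypicalX FX δ x) (hy : x ∈ candidates 𝓕 R y)
    (hne : swDecoder 𝓕 FX δ bin (swEncoder FX δ bin x) y ≠ x) :
    ∃ x' ∈ candidates 𝓕 R y, x' ≠ x ∧ bin x' = bin x := by
  have h : ∃ x', IsTypicalX FX δ x' ∧ x' ∈ candidates 𝓕 R y ∧ bin x' = bin x := ⟨x, hx, hy, rfl⟩
  rw [swEncoder, if_pos hx, swDecoder, dif_pos h] at hne
  exact ⟨h.choose, h.choose_spec.2.1, hne, h.choose_spec.2.2⟩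

/-- Two distinct observations share a bin with probability at most one over the number of bins. -/
theorem card_collision_mul_le {A M : Type*} [Fintype A] [DecidableEq A] [Fintype M]
    [DecidableEq M] {a a' : A} (h : a' ≠ a) :
    (Finset.univ.filter fun bin : A → M => bin a' = bin a).card * Fintype.card M ≤
      Fintype.card (A → M) := by
  rw [← Finset.card_univ (α := M), ← Finset.card_product, ← Finset.card_univ]
  -- Overwriting the bin of `a` is injective, because the bin of `a'` still tells the old value.
  refine Finset.card_le_card_of_injOn (fun w => Function.update w.1 a w.2)
    (fun _ _ => Finset.mem_univ _) ?_
  rintro ⟨b, m⟩ hb ⟨b', m'⟩ hb' heq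
  simp only [Finset.coe_product, Finset.coe_filter, Finset.mem_univ, true_and, Set.mem_prod,
    Set.mem_ofPred_eq] at hb hb'
  dsimp only at heq
  have hval : ∀ z, z ≠ a → b z = b' z := fun z hz => by
    simpa [hz] using congrFun heq z
  have hm : m = m' := by simpa using congrFun heq a
  refine Prod.ext (funext fun z => ?_) hm
  by_cases hz : z = a
  · rw [hz]
    exact (hb.1.symm.trans (hval a' h)).trans hb'.1
  · exact hval z hz

/-- Expected number of collisions of a given observation with another one, multiplied by the number
of binnings. -/
theorem sum_collision_le {A M : Type*} [Fintype A] [DecidableEq A] [Fintype M]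
    [DecidableEq M] [Nonempty M] (a a' : A) :
    ∑ bin : A → M, (if a' ≠ a ∧ bin a' = bin a then (1 : ℝ) else 0) ≤
      (Fintype.card (A → M) : ℝ) / (Fintype.card M : ℝ) := by
  by_cases h : a' = a
  · simp only [h, ne_eq, not_true_eq_false, false_and, if_false, Finset.sum_const_zero]
    positivity
  · rw [le_div_iff₀ (Nat.cast_pos.2 Fintype.card_pos)]
    simp only [ne_eq, h, not_false_eq_true, true_and, Finset.sum_boole]
    exact_mod_cast card_collision_mul_le h

open Classical in
/-- Probability, under the sequence of joint laws `F`, that the Slepian-Wolf decoder errs, averaged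
over the binning. -/
def swErrorProb [Nonempty 𝒳] (FX : Fin K → PMF 𝒳) (δ R : ℝ) (n : ℕ) (F : Fin K → 𝓕) : ℝ :=
  (∑ bin : Blocks 𝒳 K n → Message n R,
    eventProb F fun x y => swDecoder 𝓕 FX δ bin (swEncoder FX δ bin x) y ≠ x) /
      (Fintype.card (Blocks 𝒳 K n → Message n R) : ℝ)

theorem swErrorProb_nonneg [Nonempty 𝒳] (FX : Fin K → PMF 𝒳) (δ R : ℝ) (n : ℕ)
    (F : Fin K → 𝓕) : 0 ≤ swErrorProb FX δ R n F :=
  div_nonneg (Finset.sum_nonneg fun _ _ => eventProb_nonneg _ _) (Nat.cast_nonneg _)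

theorem swErrorProb_le_one [Nonempty 𝒳] (FX : Fin K → PMF 𝒳) (δ R : ℝ) (n : ℕ)
    (F : Fin K → 𝓕) : swErrorProb FX δ R n F ≤ 1 := by
  refine div_le_one_of_le₀ ?_ (Nat.cast_nonneg _)
  refine (Finset.sum_le_sum fun _ _ => eventProb_le_one _ _).trans ?_
  simp

theorem swOutageProb_eq [Nonempty 𝒳] (PF : PMF 𝓕) (FX : Fin K → PMF 𝒳) (FY : Fin K → PMF 𝒴)
    (δ R : ℝ) (n : ℕ) :
    swOutageProb (n := n) (R := R) PF FX FY δ (swDecoder 𝓕 FX δ) =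
      ∑ F : Fin K → 𝓕, posterior PF FX FY F * swErrorProb FX δ R n F := by
  simp only [swOutageProb, swErrorProb, outageProb_eq]
  rw [Finset.sum_comm, Finset.sum_div]
  refine Finset.sum_congr rfl fun F _ => ?_
  rw [← Finset.mul_sum, mul_div_assoc]

open Classical in
/-- The error probability for a fixed binning, by the union bound over the other candidates. -/
theorem eventProb_swDecoder_ne_le [Nonempty 𝒳] (FX : Fin K → PMF 𝒳) (δ R : ℝ) {n : ℕ}
    (F : Fin K → 𝓕) (bin : Blocks 𝒳 K n → Message n R) :
    eventProb F (fun x y => swDecoder 𝓕 FX δ bin (swEncoder FX δ bin x) y ≠ x) ≤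
      eventProb (n := n) F (fun x _ => ¬ IsTypicalX FX δ x) +
      eventProb (n := n) F (fun x y => x ∉ candidates 𝓕 R y) +
      ∑ x, ∑ y, obsProb F x y * ∑ x' with x' ∈ candidates 𝓕 R y,
        if x' ≠ x ∧ bin x' = bin x then 1 else 0 := by
  simp only [eventProb, ← Finset.sum_add_distrib]
  refine Finset.sum_le_sum fun x _ => Finset.sum_le_sum fun y _ => ?_
  have h0 := obsProb_nonneg F x y
  have hs0 : 0 ≤ ∑ x' with x' ∈ candidates 𝓕 R y,
      (if x' ≠ x ∧ bin x' = bin x then (1 : ℝ) else 0) :=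
    Finset.sum_nonneg fun _ _ => by split_ifs <;> norm_num
  have hp0 := mul_nonneg h0 hs0
  by_cases h1 : IsTypicalX FX δ x
  · by_cases h2 : x ∈ candidates 𝓕 R y
    · by_cases h3 : swDecoder 𝓕 FX δ bin (swEncoder FX δ bin x) y = x
      · simpa [h1, h2, h3] using hp0
      · obtain ⟨x', hx', hne, hbin⟩ := exists_collision h1 h2 h3
        have : 1 ≤ ∑ x' with x' ∈ candidates 𝓕 R y,
            (if x' ≠ x ∧ bin x' = bin x then (1 : ℝ) else 0) := by
          refine le_trans ?_ (Finset.single_le_sum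
            (f := fun x' => if x' ≠ x ∧ bin x' = bin x then (1 : ℝ) else 0)
            (fun _ _ => by split_ifs <;> norm_num)
            (Finset.mem_filter.2 ⟨Finset.mem_univ x', hx'⟩))
          simp [hne, hbin]
        rw [if_pos h3, if_neg (not_not.2 h1), if_neg (not_not.2 h2), zero_add, zero_add]
        exact le_mul_of_one_le_right h0 this
    · rw [if_neg (not_not.2 h1), if_pos h2]
      split_ifs <;> linarith
  · rw [if_pos h1]
    split_ifs <;> linarith
open Classical in
theorem swErrorProb_le [Nonempty 𝒳] (FX : Fin K → PMF 𝒳) (δ R : ℝ) (n : ℕ) (F : Fin K → 𝓕) :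
    swErrorProb FX δ R n F ≤ eventProb (n := n) F (fun x _ => ¬ IsTypicalX FX δ x) +
      eventProb (n := n) F (fun x y => x ∉ candidates 𝓕 R y) +
      (∑ F' : Fin K → 𝓕 with sumCondEntropy F' < R,
        2 ^ ((n : ℝ) * ((sumCondEntropy F' + R) / 2))) / Fintype.card (Message n R) := by
  set N : ℝ := (Fintype.card (Blocks 𝒳 K n → Message n R) : ℝ) with hN
  set M : ℝ := (Fintype.card (Message n R) : ℝ) with hM
  set C : ℝ := ∑ F' : Fin K → 𝓕 with sumCondEntropy F' < R,
        (2 : ℝ) ^ ((n : ℝ) * ((sumCondEntropy F' + R) / 2)) with hC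
  have hN0 : 0 < N := Nat.cast_pos.2 Fintype.card_pos
  have hM0 : 0 < M := Nat.cast_pos.2 Fintype.card_pos
  have hcoll : ∑ bin : Blocks 𝒳 K n → Message n R, ∑ x, ∑ y, obsProb F x y *
      ∑ x' with x' ∈ candidates 𝓕 R y, (if x' ≠ x ∧ bin x' = bin x then 1 else 0) ≤
      C * (N / M) := by
    have htotal : C * (N / M) =
        (∑ x : Blocks 𝒳 K n, ∑ y : Blocks 𝒴 K n, obsProb F x y) * (C * (N / M)) := by
      rw [sum_obsProb, one_mul]
    rw [Finset.sum_comm, htotal, Finset.sum_mul]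
    refine Finset.sum_le_sum fun x _ => ?_
    rw [Finset.sum_comm, Finset.sum_mul]
    refine Finset.sum_le_sum fun y _ => ?_
    rw [← Finset.mul_sum]
    refine mul_le_mul_of_nonneg_left ?_ (obsProb_nonneg F x y)
    rw [Finset.sum_comm]
    refine (Finset.sum_le_sum fun x' _ => sum_collision_le x x').trans ?_
    rw [Finset.sum_const, nsmul_eq_mul]
    exact mul_le_mul_of_nonneg_right (card_candidates_le R y) (by positivity)
  rw [swErrorProb, div_le_iff₀ hN0]
  refine (Finset.sum_le_sum fun bin _ =>
    eventProb_swDecoder_ne_le FX δ R F bin).trans ?_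
  rw [Finset.sum_add_distrib, Finset.sum_const, Finset.card_univ, nsmul_eq_mul, ← hN]
  refine (add_le_add le_rfl hcoll).trans (le_of_eq ?_)
  field_simp

/-- Universality of the decoder: the averaged error probability vanishes under every sequence of
joint laws with the given marginals whose sum of conditional entropies is below the rate. -/
theorem tendsto_swErrorProb [Nonempty 𝒳] (hK : 1 ≤ K) {FX : Fin K → PMF 𝒳} {F : Fin K → 𝓕}
    (hF : ∀ τ, margX (F τ : PMF (𝒳 × 𝒴)) = FX τ) {δ R : ℝ} (hδ : 0 < δ)
    (hR : sumCondEntropy F < R) :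
    Filter.Tendsto (fun n => swErrorProb FX δ R n F) Filter.atTop (nhds 0) := by
  classical
  have hγ : 0 < (R - sumCondEntropy F) / 2 := by linarith
  have hcand : ∀ n : ℕ, eventProb (n := n) F (fun x y => x ∉ candidates 𝓕 R y) ≤
      eventProb (n := n) F fun x y => (n : ℝ) * ((R - sumCondEntropy F) / 2) ≤
        |condInfo F x y - n * sumCondEntropy F| := by
    refine fun n => eventProb_mono F fun x y hxy hx => ?_
    by_contra hdev
    refine hx ⟨F, hR, hxy, ?_⟩
    rw [← obsProb_mul_two_rpow_condInfo hxy]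
    gcongr
    · exact one_le_two
    · have := (abs_lt.1 (not_le.1 hdev)).2
      nlinarith
  have hcoll : ∀ n : ℕ, (∑ F' : Fin K → 𝓕 with sumCondEntropy F' < R,
      (2 : ℝ) ^ ((n : ℝ) * ((sumCondEntropy F' + R) / 2))) / Fintype.card (Message n R) ≤
      ∑ F' : Fin K → 𝓕 with sumCondEntropy F' < R,
        2 * (2 : ℝ) ^ (-((n : ℝ) * ((R - sumCondEntropy F') / 2))) := by
    intro n
    rw [Finset.sum_div]
    refine Finset.sum_le_sum fun F' _ => ?_
    refine (div_le_div_of_nonneg_left (by positivity) (by positivity)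
      (two_rpow_le_card_message n R)).trans (le_of_eq ?_)
    have htwo : ∀ e : ℝ, 2 * (2 : ℝ) ^ e = 2 ^ (1 + e) := fun e => by
      rw [Real.rpow_add two_pos, Real.rpow_one]
    rw [← Real.rpow_sub two_pos, htwo]
    ring_nf
  have hlim := ((tendsto_eventProb_not_isTypicalX hK hF hδ).add
    (tendsto_eventProb_condInfo F hγ)).add
    (tendsto_finsetSum (Finset.univ.filter fun F' : Fin K → 𝓕 => sumCondEntropy F' < R)
      fun F' hF' => (tendsto_two_rpow_neg (c := (R - sumCondEntropy F') / 2)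
        (by linarith [(Finset.mem_filter.1 hF').2])).const_mul 2)
  refine squeeze_zero (fun n => swErrorProb_nonneg _ _ _ _ _) (fun n => ?_) (by simpa using hlim)
  exact (swErrorProb_le FX δ R n F).trans
    (add_le_add (add_le_add le_rfl (hcand n)) (hcoll n))

/-- Direct part: every feasible rate is achievable by Slepian-Wolf encoding. -/
theorem feasibleRates_subset_swAchievableRates (hK : 1 ≤ K) (PF : PMF 𝓕) (FX : Fin K → PMF 𝒳)
    (FY : Fin K → PMF 𝒴) (ε : ℝ) {δ : ℝ} (hδ : 0 < δ) :
    feasibleRates PF FX FY ε ⊆ swAchievableRates PF FX FY ε δ := by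
  classical
  have : Nonempty 𝒳 := ⟨(FX ⟨0, hK⟩).support_nonempty.choose⟩
  rintro R ⟨hR0, hR⟩
  refine ⟨hR0, fun n => swDecoder 𝓕 FX δ, fun η hη => ?_⟩
  have hgood : Filter.Tendsto (fun n => ∑ F : Fin K → 𝓕 with ¬ R ≤ sumCondEntropy F,
      posterior PF FX FY F * swErrorProb FX δ R n F) Filter.atTop (nhds 0) := by
    rw [← Finset.sum_const_zero (s := Finset.univ.filter fun F : Fin K → 𝓕 =>
      ¬ R ≤ sumCondEntropy F)]
    refine tendsto_finsetSum _ fun F hF => ?_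
    by_cases hm : HasMarginals FX FY F
    · simpa using (tendsto_swErrorProb hK (fun τ => (hm τ).1) hδ
        (not_le.1 (Finset.mem_filter.1 hF).2)).const_mul (posterior PF FX FY F)
    · simp [posterior, hm]
  filter_upwards [hgood.eventually_lt_const hη] with n hn
  rw [swOutageProb_eq, ← Finset.sum_filter_add_sum_filter_not Finset.univ
    (fun F : Fin K → 𝓕 => R ≤ sumCondEntropy F)]
  refine add_le_add (le_trans (Finset.sum_le_sum fun F _ => ?_) hR) hn.le
  exact mul_le_of_le_one_right (posterior_nonneg PF FX FY F) (swErrorProb_le_one _ _ _ _ _)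

/-! ### Comparison of the sets of rates -/

/-- Some binning is at least as good as the average. -/
theorem swAchievableRates_subset_achievableRates (PF : PMF 𝓕) (FX : Fin K → PMF 𝒳)
    (FY : Fin K → PMF 𝒴) (ε δ : ℝ) :
    swAchievableRates PF FX FY ε δ ⊆ achievableRates PF FX FY ε := by
  classical
  rintro R ⟨hR0, dec, hdec⟩
  have hbin : ∀ n : ℕ, ∃ bin : Blocks 𝒳 K n → Message n R,
      outageProb PF FX FY (swEncoder FX δ bin) (dec n bin) ≤
        swOutageProb PF FX FY δ (dec n) := by
    intro n
    obtain ⟨bin, -, hb⟩ := Finset.exists_le_of_sum_le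
      (s := (Finset.univ : Finset (Blocks 𝒳 K n → Message n R)))
      (f := fun bin => outageProb PF FX FY (swEncoder FX δ bin) (dec n bin))
      (g := fun _ => swOutageProb PF FX FY δ (dec n)) Finset.univ_nonempty (by
        rw [Finset.sum_const, Finset.card_univ, nsmul_eq_mul, swOutageProb, mul_div_cancel₀]
        exact_mod_cast Fintype.card_ne_zero)
    exact ⟨bin, hb⟩
  choose bin hb using hbin
  refine ⟨hR0, fun n => swEncoder FX δ (bin n), fun n => dec n (bin n), fun η hη => ?_⟩
  filter_upwards [hdec η hη] with n hn
  exact (hb n).trans hn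

/-- Above all sums of conditional entropies the constraint is void. -/
theorem feasibleRates_nonempty (PF : PMF 𝓕) (FX : Fin K → PMF 𝒳) (FY : Fin K → PMF 𝒴) {ε : ℝ}
    (hε : 0 ≤ ε) : (feasibleRates PF FX FY ε).Nonempty := by
  classical
  obtain ⟨B, hB⟩ := (Set.finite_range (sumCondEntropy : (Fin K → 𝓕) → ℝ)).bddAbove
  refine ⟨max 0 (B + 1), le_max_left _ _, ?_⟩
  rw [Finset.filter_false_of_mem, Finset.sum_empty]
  · exact hε
  · intro F _ hF
    have h1 := hB ⟨F, rfl⟩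
    have h2 := (le_max_right 0 (B + 1)).trans hF
    linarith

/-- A set of rates between the feasible and the achievable ones has infimum `optimalRate`. -/
theorem isGLB_optimalRate {PF : PMF 𝓕} {FX : Fin K → PMF 𝒳} {FY : Fin K → PMF 𝒴} {ε : ℝ}
    (hε : 0 ≤ ε) {S : Set ℝ} (h1 : feasibleRates PF FX FY ε ⊆ S)
    (h2 : S ⊆ achievableRates PF FX FY ε) : IsGLB S (optimalRate PF FX FY ε) := by
  have hbdd : BddBelow (feasibleRates PF FX FY ε) := ⟨0, fun _ h => h.1⟩
  refine ⟨fun R hR => ?_, fun b hb => ?_⟩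
  · refine le_of_forall_gt_imp_ge_of_dense fun R' hR' => ?_
    exact csInf_le hbdd (mem_feasibleRates_of_achievable (h2 hR) hR')
  · exact le_csInf (feasibleRates_nonempty PF FX FY hε) fun R hR => hb (h1 hR)

end
end TimeVaryingSW

theorem theorem1 {𝒳 𝒴 : Type*} [Fintype 𝒳] [Fintype 𝒴]
    (𝓕 : Finset (PMF (𝒳 × 𝒴))) (PF : PMF 𝓕)
    (K : ℕ) (hK : 1 ≤ K) (FX : Fin K → PMF 𝒳) (FY : Fin K → PMF 𝒴)
    (hF : 0 < TimeVaryingSW.marginalsProb PF FX FY)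
    (ε : ℝ) (hε : 0 < ε) :
    (TimeVaryingSW.feasibleRates PF FX FY ε).Nonempty ∧
    IsGLB (TimeVaryingSW.achievableRates PF FX FY ε) (TimeVaryingSW.optimalRate PF FX FY ε) ∧
    ∀ δ : ℝ, 0 < δ →
      TimeVaryingSW.feasibleRates PF FX FY ε ⊆ TimeVaryingSW.swAchievableRates PF FX FY ε δ ∧
      IsGLB (TimeVaryingSW.swAchievableRates PF FX FY ε δ)
        (TimeVaryingSW.optimalRate PF FX FY ε) := by
  have hdirect := fun (δ : ℝ) (hδ : 0 < δ) =>
    TimeVaryingSW.feasibleRates_subset_swAchievableRates hK PF FX FY ε hδ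
  have hsub := TimeVaryingSW.swAchievableRates_subset_achievableRates PF FX FY ε
  refine ⟨TimeVaryingSW.feasibleRates_nonempty PF FX FY hε.le,
    TimeVaryingSW.isGLB_optimalRate hε.le ((hdirect 1 one_pos).trans (hsub 1)) subset_rfl,
    fun δ hδ => ⟨hdirect δ hδ, ?_⟩⟩
  exact TimeVaryingSW.isGLB_optimalRate hε.le (hdirect δ hδ) (hsub δ)
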